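/- **Setting.** Probabilistic programs over real variables $x_1,\dots,x_n$ are built from $\mathbf{skip}$, assignments $x_j:=E$ ($E$ a Borel-measurable expression), $x_j:=\mathbf{sample}(d)$ ($d$ a probability distribution on $\mathbb R$), $x_j:=\mathbf{ndet}(D)$ ($\emptyset\ne D\subseteq\mathbb R$ Borel), sequential composition, $\mathbf{if}\ g\ \mathbf{then}\ Q_1\ \mathbf{else}\ Q_2\ \mathbf{fi}$ (where $g$ is a measurable predicate, $\mathbf{prob}(p)$ with $p\in[0,1]$, or the nondeterministic choice $\star$) and $\mathbf{while}\ \Phi\ \mathbf{do}\ Q\ \mathbf{od}$ ($\Phi$ a measurable predicate); a program also has a predicate describing its possible initial valuations. Its control flow graph has as locations the values of the program counter, with a terminal location $\ell^{out}$ carrying a self-loop. A configuration is a pair $(\ell,x)$ of a location and a valuation $x\in\mathbb R^n$; $(\ell',x')$ is a successor of $(\ell,x)$ if one step of the program may lead there (after $\mathbf{sample}(d)$: with a new value in the closed support of $d$), and a configuration is reachable if a finite sequence of successor steps leads to it from an initial configuration. A measurable scheduler assigns, measurably, to every finite path ending in a nondeterministic configuration a probability distribution on its successors; a scheduler and an initial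 configuration determine a probability measure on runs. A program terminates almost surely if, for every measurable scheduler and every initial configuration, the run reaches $\ell^{out}$ with probability $1$. Let $\mathcal P=\mathbf{while}\ \Psi\ \mathbf{do}\ \mathcal B\ \mathbf{od}$. Let $\mathit{loops}(\mathcal P)$ be the set of locations of $\mathcal P$ that are at the head or in the body of a while-loop occurring in $\mathcal B$, and $\mathit{slice}(\mathcal P)$ the set of all other locations. An invariant map $I$ assigns to each location $\ell$ a Borel set $I(\ell)\subseteq\mathbb R^n$ such that $x\in I(\ell)$ for each reachable $(\ell,x)$. For functions $\eta(\ell,\cdot):\mathbb R^n\to\mathbb R$ and $\varepsilon\ge 0$, say that $\eta$ is $\varepsilon$-$I$-ranking in $\ell$ if, for each $x\in I(\ell)$, the value of $\eta$ after the next step is at most $\eta(\ell,x)-\varepsilon$: for each enabled transition at a deterministic or nondeterministic branching location; for each possible value $a\in D$ at $x_j:=\mathbf{ndet}(D)$; for the new valuation at $x_j:=E$; in expectation at a probabilistic branching; and at $x_j:=\mathbf{sample}(d)$ with next location $\ell'$, $a\mapsto\eta(\ell',x(j\leftarrow a))$ is $d$-integrable with $\mathbb E_{a\sim d}[\eta(\ell',x(j\leftarrow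 a))]\le\eta(\ell,x)-\varepsilon$. A (1-dimensional) NC supermartingale for $\mathcal P$ supported by $I$ is a map $\eta$ such that each $\eta(\ell,\cdot)$ is Borel measurable, $\eta(\ell,x)\ge 0$ for all $\ell$ and all $x\in I(\ell)$, and for some $\varepsilon>0$ the map $\eta$ is $\varepsilon$-$I$-ranking in each $\ell\in\mathit{slice}(\mathcal P)\setminus\{\ell^{out}\}$ and $0$-$I$-ranking in each $\ell\in\mathit{loops}(\mathcal P)$. **Theorem.** Assume that each loop $Q$ nested in $\mathcal P$, regarded as a program of its own, terminates almost surely from each valuation $x$ such that the configuration consisting of the head of $Q$ and $x$ is reachable in $\mathcal P$. If there is an NC supermartingale for $\mathcal P$ supported by some invariant map, then $\mathcal P$ terminates almost surely from each of its initial configurations. -/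

import Mathlib

open MeasureTheory ProbabilityTheory

noncomputable section

namespace PProg

/-! ### Syntax of probabilistic programs over the real variables `x_1, …, x_n` -/

/-- Valuations of the program variables. -/
abbrev Val (n : ℕ) : Type := Fin n → ℝ

/-- An expression, identified with the Borel-measurable function that it determines. -/
def Expr (n : ℕ) : Type := {f : Val n → ℝ // Measurable f}

/-- A predicate, identified with the (Borel) set of valuations that satisfy it. -/
def Pred (n : ℕ) : Type := {s : Set (Val n) // MeasurableSet s}

/-- Right-hand sides of assignments: an expression, `sample(d)` for a probability distribution `d`
on the reals, or `ndet(D)` for a (nonempty) Borel set `D`. -/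
inductive Update (n : ℕ) : Type
  | expr (f : Expr n)
  | sample (d : ProbabilityMeasure ℝ)
  | ndet (D : Set ℝ) (meas : MeasurableSet D) (nonempty : D.Nonempty)

/-- Guards of conditionals: nondeterministic choice `⋆`, probabilistic choice `prob(p)`, or a
predicate. -/
inductive Guard (n : ℕ) : Type
  | star
  | prob (p : unitInterval)
  | pred (φ : Pred n)

/-- Statements. -/
inductive Stmt (n : ℕ) : Type
  | skip
  | assign (j : Fin n) (u : Update n)
  | seq (a b : Stmt n)
  | ite (g : Guard n) (a b : Stmt n)
  | loop (φ : Pred n) (a : Stmt n)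

/-- A program: a preamble (the predicate of possible initial valuations) and a statement. -/
structure Program (n : ℕ) where
  init : Pred n
  stmt : Stmt n

/-! ### Probabilistic control flow graphs -/

/-- A location of a probabilistic control flow graph with set of locations `L`, given by its type
together with its outgoing transitions and their labels. -/
inductive Node (L : Type) (n : ℕ) : Type
  /-- deterministic, one outgoing transition with guard `true` -/
  | jump (t : L)
  /-- deterministic, a transition to `t₁` with guard `φ` and one to `t₂` with guard `¬ φ` -/
  | branch (φ : Pred n) (t₁ t₂ : L)
  /-- nondeterministic branching -/
  | ndbranch (t₁ t₂ : L)
  /-- probabilistic branching: to `t₁` with probability `p`, to `t₂` with probability `1 - p` -/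
  | pbranch (p : unitInterval) (t₁ t₂ : L)
  /-- assignment `x_j := u`, followed by location `t` -/
  | assign (j : Fin n) (u : Update n) (t : L)

/-- Renaming of the target locations. -/
def Node.map {L L' : Type} {n : ℕ} (f : L → L') : Node L n → Node L' n
  | jump t => jump (f t)
  | branch φ t₁ t₂ => branch φ (f t₁) (f t₂)
  | ndbranch t₁ t₂ => ndbranch (f t₁) (f t₂)
  | pbranch p t₁ t₂ => pbranch p (f t₁) (f t₂)
  | assign j u t => assign j u (f t)

/-- A probabilistic control flow graph, with an initial and a terminal location. -/
structure PCFG (L : Type) (n : ℕ) where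
  node : L → Node L n
  init : L
  term : L

/-- Configurations: a location and a valuation. -/
abbrev Conf (L : Type) (n : ℕ) : Type := L × Val n

/-- The location is nondeterministic: nondeterministic branching or nondeterministic assignment. -/
def Node.Nondet {L : Type} {n : ℕ} : Node L n → Prop
  | ndbranch _ _ => True
  | assign _ (.ndet _ _ _) _ => True
  | _ => False

/-- `c` is a possible successor of a configuration with valuation `x` at the given location. -/
def Node.Succ {L : Type} {n : ℕ} : Node L n → Val n → Conf L n → Prop
  | jump t, x, c => c = (t, x)
  | branch φ t₁ t₂, x, c => (x ∈ φ.1 ∧ c = (t₁, x)) ∨ (x ∉ φ.1 ∧ c = (t₂, x))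
  | ndbranch t₁ t₂, x, c => c = (t₁, x) ∨ c = (t₂, x)
  | pbranch _ t₁ t₂, x, c => c = (t₁, x) ∨ c = (t₂, x)
  | assign j (.expr f) t, x, c => c = (t, Function.update x j (f.1 x))
  | assign j (.sample d) t, x, c =>
      ∃ a ∈ (d : Measure ℝ).support, c = (t, Function.update x j a)
  | assign j (.ndet D _ _) t, x, c => ∃ a ∈ D, c = (t, Function.update x j a)

open Classical in
/-- The law of the next configuration from valuation `x` at the given location, where `ν` is the
choice of the scheduler, used at nondeterministic locations only. -/
def Node.law {L : Type} [MeasurableSpace L] {n : ℕ} (ν : Measure (Conf L n)) :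
    Node L n → Val n → Measure (Conf L n)
  | jump t, x => Measure.dirac (t, x)
  | branch φ t₁ t₂, x => if x ∈ φ.1 then Measure.dirac (t₁, x) else Measure.dirac (t₂, x)
  | ndbranch _ _, _ => ν
  | pbranch p t₁ t₂, x =>
      ENNReal.ofReal (p : ℝ) • Measure.dirac (t₁, x)
        + ENNReal.ofReal (1 - (p : ℝ)) • Measure.dirac (t₂, x)
  | assign j (.expr f) t, x => Measure.dirac (t, Function.update x j (f.1 x))
  | assign j (.sample d) t, x =>
      (d : Measure ℝ).map (fun a => ((t, Function.update x j a) : Conf L n))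
  | assign _ (.ndet _ _ _) _, _ => ν

namespace PCFG

variable {L : Type} {n : ℕ} (C : PCFG L n)

/-- The successor relation on configurations. -/
def Succ (c c' : Conf L n) : Prop := (C.node c.1).Succ c.2 c'

/-- `c` is reachable from some configuration in `S`. -/
def Reachable (S : Set (Conf L n)) (c : Conf L n) : Prop :=
  ∃ c₀ ∈ S, Relation.ReflTransGen C.Succ c₀ c

/-- Sequences of configurations indexed by `0, …, k`. -/
abbrev Hist (L : Type) (n k : ℕ) : Type := Finset.Iic k → Conf L n

/-- The last configuration of a sequence. -/
def Hist.last {k : ℕ} (h : Hist L n k) : Conf L n := h ⟨k, Finset.mem_Iic.2 le_rfl⟩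

/-- The sequence `h` is a finite path (of length `k`) that starts in `S`. -/
def IsPath (S : Set (Conf L n)) {k : ℕ} (h : Hist L n k) : Prop :=
  h ⟨0, Finset.mem_Iic.2 (Nat.zero_le k)⟩ ∈ S ∧
  ∀ (i : ℕ) (hi : i < k),
    C.Succ (h ⟨i, Finset.mem_Iic.2 hi.le⟩) (h ⟨i + 1, Finset.mem_Iic.2 hi⟩)

variable [MeasurableSpace L]

/-- A measurable scheduler: it assigns, in a measurable way, to every finite path that starts in `S`
and ends in a nondeterministic configuration a probability distribution on the successors of that
configuration (its values at other sequences are irrelevant). -/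
structure Scheduler (S : Set (Conf L n)) where
  choice : (k : ℕ) → Kernel (Hist L n k) (Conf L n)
  markov : ∀ k, IsMarkovKernel (choice k)
  supported : ∀ (k : ℕ) (h : Hist L n k), C.IsPath S h → (C.node (Hist.last h).1).Nondet →
    ∀ᵐ c ∂(choice k h), C.Succ (Hist.last h) c

instance {S : Set (Conf L n)} (σ : C.Scheduler S) (k : ℕ) : IsMarkovKernel (σ.choice k) :=
  σ.markov k

variable {C}

theorem measurable_last {k : ℕ} : Measurable (Hist.last : Hist L n k → Conf L n) :=
  measurable_pi_apply _

theorem measurable_law_node {k : ℕ} (κ : Kernel (Hist L n k) (Conf L n)) (v : Node L n) :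
    Measurable (fun h : Hist L n k => v.law (κ h) (Hist.last h).2) := by
  have hx : Measurable (fun h : Hist L n k => (Hist.last h).2) := measurable_snd.comp measurable_last
  have hd : ∀ (t : L) {g : Hist L n k → Val n}, Measurable g →
      Measurable (fun h => Measure.dirac ((t, g h) : Conf L n)) := fun t g hg =>
    Measure.measurable_dirac.comp (measurable_const.prodMk hg)
  rcases v with t | ⟨φ, t₁, t₂⟩ | ⟨t₁, t₂⟩ | ⟨p, t₁, t₂⟩ | ⟨j, u, t⟩
  · exact hd t hx
  · exact Measurable.ite (hx φ.2) (hd t₁ hx) (hd t₂ hx)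
  · exact κ.measurable
  · refine Measure.measurable_of_measurable_coe _ fun s hs => ?_
    simp only [Node.law, Measure.add_apply, Measure.smul_apply, smul_eq_mul]
    exact ((Measure.measurable_measure.1 (hd t₁ hx) s hs).const_mul _).add
      ((Measure.measurable_measure.1 (hd t₂ hx) s hs).const_mul _)
  · rcases u with f | d | ⟨D, hD, hne⟩
    · refine hd t (g := fun h => Function.update (Hist.last h).2 j (f.1 (Hist.last h).2)) ?_
      exact measurable_update'.comp (hx.prodMk (f.2.comp hx))
    · have hm : Measurable (fun q : Hist L n k × ℝ =>
          ((t, Function.update (Hist.last q.1).2 j q.2) : Conf L n)) :=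
        measurable_const.prodMk
          (measurable_update'.comp ((hx.comp measurable_fst).prodMk measurable_snd))
      refine Measure.measurable_of_measurable_coe _ fun s hs => ?_
      have : ∀ h : Hist L n k,
          (Node.assign j (Update.sample d) t).law (κ h) (Hist.last h).2 s
            = (d : Measure ℝ) (Prod.mk h ⁻¹'
              ((fun q : Hist L n k × ℝ =>
                ((t, Function.update (Hist.last q.1).2 j q.2) : Conf L n)) ⁻¹' s)) := by
        intro h
        exact Measure.map_apply (hm.comp measurable_prodMk_left) hs
      simp only [this]
      exact measurable_measure_prodMk_left (hm hs)
    · exact κ.measurable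

theorem isProbabilityMeasure_law (ν : Measure (Conf L n)) [IsProbabilityMeasure ν] (v : Node L n)
    (x : Val n) : IsProbabilityMeasure (v.law ν x) := by
  rcases v with t | ⟨φ, t₁, t₂⟩ | ⟨t₁, t₂⟩ | ⟨p, t₁, t₂⟩ | ⟨j, u, t⟩
  · simp only [Node.law]; infer_instance
  · simp only [Node.law]; split_ifs <;> infer_instance
  · simpa only [Node.law]
  · constructor
    simp only [Node.law, Measure.add_apply, Measure.smul_apply, measure_univ, smul_eq_mul, mul_one]
    rw [← ENNReal.ofReal_add p.2.1 (sub_nonneg.2 p.2.2)]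
    simp
  · rcases u with f | d | ⟨D, hD, hne⟩
    · simp only [Node.law]; infer_instance
    · simp only [Node.law]
      refine Measure.isProbabilityMeasure_map (Measurable.aemeasurable ?_)
      exact measurable_const.prodMk (measurable_update x)
    · simpa only [Node.law]

variable [Finite L] [DiscreteMeasurableSpace L]

/-- The one-step kernel: the law of the configuration at time `k + 1` given the first `k + 1`
configurations. -/
def step {S : Set (Conf L n)} (σ : C.Scheduler S) (k : ℕ) : Kernel (Hist L n k) (Conf L n) where
  toFun h := (C.node (Hist.last h).1).law (σ.choice k h) (Hist.last h).2
  measurable' := by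
    have h₁ : Measurable (fun q : L × Hist L n k =>
        (C.node q.1).law (σ.choice k q.2) (Hist.last q.2).2) :=
      measurable_from_prod_countable_right fun ℓ => measurable_law_node (σ.choice k) (C.node ℓ)
    exact h₁.comp ((measurable_fst.comp measurable_last).prodMk measurable_id)

instance {S : Set (Conf L n)} (σ : C.Scheduler S) (k : ℕ) : IsMarkovKernel (step σ k) :=
  ⟨fun h => isProbabilityMeasure_law (σ.choice k h) _ _⟩

/-- The law of the random run that starts in `c` and is controlled by the scheduler `σ`. -/
def runMeasure {S : Set (Conf L n)} (σ : C.Scheduler S) (c : Conf L n) :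
    Measure (ℕ → Conf L n) :=
  Kernel.traj (X := fun _ => Conf L n) (step σ) 0 (fun _ => c)

variable (C)

/-- Almost-sure termination from every configuration in `S`, under every measurable scheduler. -/
def ASTerminatesFrom (S : Set (Conf L n)) : Prop :=
  ∀ σ : C.Scheduler S, ∀ c ∈ S, ∀ᵐ ρ ∂(runMeasure σ c), ∃ i : ℕ, (ρ i).1 = C.term

end PCFG

/-! ### The control flow graph of a program -/

namespace Stmt

/-- Program points of a statement at which an instruction is about to be executed, that is, all
values of the program counter except the one after the statement. The point of a conditional or a
loop at which its guard is evaluated is `cond`, resp. `head`. -/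
inductive Pos {n : ℕ} : Stmt n → Type
  | skip : Pos .skip
  | assign {j : Fin n} {u : Update n} : Pos (.assign j u)
  | fst {a b : Stmt n} (p : Pos a) : Pos (.seq a b)
  | snd {a b : Stmt n} (p : Pos b) : Pos (.seq a b)
  | cond {g : Guard n} {a b : Stmt n} : Pos (.ite g a b)
  | thn {g : Guard n} {a b : Stmt n} (p : Pos a) : Pos (.ite g a b)
  | els {g : Guard n} {a b : Stmt n} (p : Pos b) : Pos (.ite g a b)
  | head {φ : Pred n} {a : Stmt n} : Pos (.loop φ a)
  | body {φ : Pred n} {a : Stmt n} (p : Pos a) : Pos (.loop φ a)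

variable {n : ℕ}

/-- Locations of the control flow graph of `S`: the points of `S`, and the location `out` after
`S`. -/
inductive Loc (S : Stmt n) : Type
  | pt (p : S.Pos)
  | out

instance (S : Stmt n) : MeasurableSpace S.Loc := ⊤

instance (S : Stmt n) : DiscreteMeasurableSpace S.Loc := ⟨fun _ => trivial⟩

theorem finite_pos (S : Stmt n) : Finite S.Pos := by
  induction S with
  | skip => exact Finite.of_surjective (fun _ : Unit => Pos.skip) (by rintro ⟨⟩; exact ⟨(), rfl⟩)
  | assign j u =>
    exact Finite.of_surjective (fun _ : Unit => Pos.assign) (by rintro ⟨⟩; exact ⟨(), rfl⟩)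
  | seq a b iha ihb =>
    refine Finite.of_surjective (Sum.elim Pos.fst Pos.snd : a.Pos ⊕ b.Pos → _) ?_
    intro q
    cases q with
    | fst p => exact ⟨.inl p, rfl⟩
    | snd p => exact ⟨.inr p, rfl⟩
  | ite g a b iha ihb =>
    refine Finite.of_surjective
      (Sum.elim (fun _ => Pos.cond) (Sum.elim Pos.thn Pos.els) : Unit ⊕ (a.Pos ⊕ b.Pos) → _) ?_
    intro q
    cases q with
    | cond => exact ⟨.inl (), rfl⟩
    | thn p => exact ⟨.inr (.inl p), rfl⟩
    | els p => exact ⟨.inr (.inr p), rfl⟩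
  | loop φ a iha =>
    refine Finite.of_surjective
      (Sum.elim (fun _ => Pos.head) Pos.body : Unit ⊕ a.Pos → _) ?_
    intro q
    cases q with
    | head => exact ⟨.inl (), rfl⟩
    | body p => exact ⟨.inr p, rfl⟩

instance (S : Stmt n) : Finite S.Loc := by
  have := S.finite_pos
  refine Finite.of_surjective (fun o : Option S.Pos => o.elim Loc.out Loc.pt) ?_
  rintro (p | _)
  · exact ⟨some p, rfl⟩
  · exact ⟨none, rfl⟩

/-- The point at which the execution of `S` starts. -/
def entry : (S : Stmt n) → S.Pos
  | .skip => .skip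
  | .assign _ _ => .assign
  | .seq a _ => .fst a.entry
  | .ite _ _ _ => .cond
  | .loop _ _ => .head

/-- The instruction at a point, with its target locations. -/
def node : {S : Stmt n} → S.Pos → Node S.Loc n
  | _, .skip => .jump .out
  | _, .assign (j := j) (u := u) => .assign j u .out
  | _, .fst (b := b) p => (node p).map fun
      | .pt q => .pt (.fst q)
      | .out => .pt (.snd b.entry)
  | _, .snd p => (node p).map fun
      | .pt q => .pt (.snd q)
      | .out => .out
  | _, .cond (g := .star) (a := a) (b := b) =>
      .ndbranch (Loc.pt (.thn a.entry)) (Loc.pt (.els b.entry))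
  | _, .cond (g := .prob p) (a := a) (b := b) =>
      .pbranch p (Loc.pt (.thn a.entry)) (Loc.pt (.els b.entry))
  | _, .cond (g := .pred φ) (a := a) (b := b) =>
      .branch φ (Loc.pt (.thn a.entry)) (Loc.pt (.els b.entry))
  | _, .thn p => (node p).map fun
      | .pt q => .pt (.thn q)
      | .out => .out
  | _, .els p => (node p).map fun
      | .pt q => .pt (.els q)
      | .out => .out
  | _, .head (φ := φ) (a := a) => .branch φ (Loc.pt (.body a.entry)) .out
  | _, .body p => (node p).map fun
      | .pt q => .pt (.body q)
      | .out => .pt .head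

/-- The control flow graph of a statement; there is a self-loop on the terminal location. -/
def pcfg (S : Stmt n) : PCFG S.Loc n where
  node
    | .pt p => Stmt.node p
    | .out => .jump .out
  init := Loc.pt S.entry
  term := Loc.out

/-- The elementary, conditional or loop statement that starts at a point. -/
def stmtAt : {S : Stmt n} → S.Pos → Stmt n
  | _, .skip => .skip
  | _, .assign (j := j) (u := u) => .assign j u
  | _, .fst p => stmtAt p
  | _, .snd p => stmtAt p
  | _, .cond (g := g) (a := a) (b := b) => .ite g a b
  | _, .thn p => stmtAt p
  | _, .els p => stmtAt p
  | _, .head (φ := φ) (a := a) => .loop φ a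
  | _, .body p => stmtAt p

/-- The point belongs to (the head or the body of) some loop that occurs in the statement. -/
def InLoop : {S : Stmt n} → S.Pos → Prop
  | _, .skip => False
  | _, .assign => False
  | _, .fst p => InLoop p
  | _, .snd p => InLoop p
  | _, .cond => False
  | _, .thn p => InLoop p
  | _, .els p => InLoop p
  | _, .head => True
  | _, .body _ => True

/-- For the program `while Ψ do B od`, the locations that belong to some nested loop. -/
def loops (Ψ : Pred n) (B : Stmt n) : Set (loop Ψ B).Loc :=
  {ℓ | ∃ p : B.Pos, InLoop p ∧ ℓ = Loc.pt (.body p)}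

/-- The locations of `while Ψ do B od` that do not belong to any nested loop. -/
def slice (Ψ : Pred n) (B : Stmt n) : Set (loop Ψ B).Loc := (loops Ψ B)ᶜ

end Stmt

namespace Program

variable {n : ℕ} (P : Program n)

/-- The initial configurations. -/
def initConfs : Set (Conf P.stmt.Loc n) := {c | c.1 = P.stmt.pcfg.init ∧ c.2 ∈ P.init.1}

/-- The configurations that are reachable from some initial configuration. -/
def Reachable (c : Conf P.stmt.Loc n) : Prop := P.stmt.pcfg.Reachable P.initConfs c

/-- Almost-sure termination, from each initial configuration and under each scheduler. -/
def ASTerminates : Prop := P.stmt.pcfg.ASTerminatesFrom P.initConfs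

/-- Invariant maps: Borel sets of valuations that over-approximate the reachable valuations. -/
def IsInvariant (I : P.stmt.Loc → Set (Val n)) : Prop :=
  (∀ ℓ, MeasurableSet (I ℓ)) ∧ ∀ c : Conf P.stmt.Loc n, P.Reachable c → c.2 ∈ I c.1

end Program

/-! ### Supermartingales -/

/-- Each (generalized) transition that is enabled at valuation `x` in the given location leads to an
expected value of `η` that is at most `r`: for deterministic, probabilistic and nondeterministic
branching and for deterministic, probabilistic and nondeterministic assignments. -/
def Node.Ranked {L : Type} {n : ℕ} (η : L → Val n → ℝ) (r : ℝ) : Node L n → Val n → Prop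
  | jump t, x => η t x ≤ r
  | branch φ t₁ t₂, x => (x ∈ φ.1 → η t₁ x ≤ r) ∧ (x ∉ φ.1 → η t₂ x ≤ r)
  | ndbranch t₁ t₂, x => η t₁ x ≤ r ∧ η t₂ x ≤ r
  | pbranch p t₁ t₂, x => (p : ℝ) * η t₁ x + (1 - (p : ℝ)) * η t₂ x ≤ r
  | assign j (.expr f) t, x => η t (Function.update x j (f.1 x)) ≤ r
  | assign j (.sample d) t, x =>
      Integrable (fun a => η t (Function.update x j a)) (d : Measure ℝ) ∧
        ∫ a, η t (Function.update x j a) ∂(d : Measure ℝ) ≤ r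
  | assign j (.ndet D _ _) t, x => ∀ a ∈ D, η t (Function.update x j a) ≤ r

/-- `η` is `ε`-`I`-ranking in the location `ℓ`. -/
def PCFG.Ranking {L : Type} {n : ℕ} (C : PCFG L n) (η : L → Val n → ℝ) (I : L → Set (Val n))
    (ε : ℝ) (ℓ : L) : Prop :=
  ∀ x ∈ I ℓ, (C.node ℓ).Ranked η (η ℓ x - ε) x

/-- `η` is `I`-unaffected in the location `ℓ`. -/
def PCFG.Unaffecting {L : Type} {n : ℕ} (C : PCFG L n) (η : L → Val n → ℝ) (I : L → Set (Val n))
    (ℓ : L) : Prop :=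
  C.Ranking η I 0 ℓ

/-- `η` is a (1-dimensional) non-negative compositional supermartingale for `while Ψ do B od`,
supported by `I`. Ranking is not required in the terminal location, whose only transition is a
self-loop. -/
structure IsNCSM {n : ℕ} (Ψ : Pred n) (B : Stmt n) (I : (Stmt.loop Ψ B).Loc → Set (Val n))
    (η : (Stmt.loop Ψ B).Loc → Val n → ℝ) : Prop where
  measurable : ∀ ℓ, Measurable (η ℓ)
  nonneg : ∀ ℓ, ∀ x ∈ I ℓ, 0 ≤ η ℓ x
  ranking : ∃ ε > 0,
    (∀ ℓ ∈ Stmt.slice Ψ B, ℓ ≠ (Stmt.loop Ψ B).pcfg.term →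
      (Stmt.loop Ψ B).pcfg.Ranking η I ε ℓ)
  unaffecting : ∀ ℓ ∈ Stmt.loops Ψ B, (Stmt.loop Ψ B).pcfg.Unaffecting η I ℓ

/-- Each loop `Q` nested in `while Ψ do B od`, regarded as a program of its own, terminates almost
surely when it is started from any configuration at its head that is reachable in
`while Ψ do B od`. -/
def NestedLoopsTerminate {n : ℕ} (init : Pred n) (Ψ : Pred n) (B : Stmt n) : Prop :=
  ∀ (p : B.Pos) (Φ : Pred n) (D : Stmt n), Stmt.stmtAt p = Stmt.loop Φ D →
    ∀ x : Val n, (Program.mk init (Stmt.loop Ψ B)).Reachable (Stmt.Loc.pt (Stmt.Pos.body p), x) →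
      (Program.mk ⟨{x}, measurableSet_singleton x⟩ (Stmt.loop Φ D)).ASTerminates

end PProg

end

/-! Let `η` be the supermartingale of `while Ψ do B od`, with constant `ε`. Almost every run is an
infinite path of the control flow graph (`PCFG.ae_isPath`), so it only meets reachable
configurations, where `η` is non-negative and does not increase in expectation. At the head of the
outer loop, which lies in the slice, it decreases in expectation by `ε`. Hence the expected number
of visits to this head is at most `η / ε`, and by Borel-Cantelli almost every run visits it finitely
often (`PCFG.ae_finite_visits`). No other property of the slice is needed.

On the other hand, almost no run stays in the body `B` forever (`Stmt.Embeds.ae_leaves`). This goes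
by induction on the statement: elementary statements are left after one step, conditionals and
sequential compositions are left once their parts are, and a nested loop is left because it
terminates almost surely as a program of its own. So a run that never reaches the terminal location
returns to the head of the outer loop again and again, which almost surely does not happen.

The step for a nested loop `Q` compares two control flow graphs
(`Stmt.Embeds.ae_not_forall_mem_range`). Given a finite path `h` of the outer program that ends at
the head of `Q`, the scheduler of the outer program induces a scheduler of `Q`: it plays, after a
path of `Q`, what the given scheduler plays after `h` followed by the copy of this path
(`Stmt.Embeds.scheduler`). A run of the outer program that continues `h` is distributed like a run
of `Q` under that scheduler as long as it remains in `Q` (`Stmt.Embeds.lintegral_traj_le`), so the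
probability that it remains in `Q` forever is zero. The Markov property
(`ae_traj_of_ae_ae_traj`) transfers this to runs from the initial configurations, for each time at
which `Q` may be entered. -/

noncomputable section

open Preorder
open scoped ENNReal

namespace PProg

/-! ### Trajectories of history-dependent kernels -/

section Trajectories

variable {X : Type*} [MeasurableSpace X] {κ : (k : ℕ) → Kernel (Finset.Iic k → X) X}
  [∀ k, IsMarkovKernel (κ k)] {a b : ℕ}

theorem lintegral_traj_succ (hab : a ≤ b) (h : Finset.Iic a → X)
    {f : (Finset.Iic b → X) × X → ℝ≥0∞} (hf : Measurable f) :
    ∫⁻ ρ, f (frestrictLe b ρ, ρ (b + 1)) ∂(Kernel.traj (X := fun _ => X) κ a h) =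
      ∫⁻ ρ, ∫⁻ c, f (frestrictLe b ρ, c) ∂(κ b (frestrictLe b ρ))
        ∂(Kernel.traj (X := fun _ => X) κ a h) := by
  have hm : Measurable (fun ρ : ℕ → X => (frestrictLe (π := fun _ => X) b ρ, ρ (b + 1))) := by
    fun_prop
  rw [← lintegral_map (μ := Kernel.traj (X := fun _ => X) κ a h) hf hm,
    ← Kernel.partialTraj_compProd_eq_map_traj (X := fun _ => X) hab, Measure.lintegral_compProd hf,
    ← Kernel.traj_map_frestrictLe_apply (X := fun _ => X) a b h,
    lintegral_map hf.lintegral_kernel_prod_right' (by fun_prop)]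

theorem ae_traj_succ (hab : a ≤ b) (h : Finset.Iic a → X) {s : Set ((Finset.Iic b → X) × X)}
    (hs : MeasurableSet s)
    (H : ∀ᵐ ρ ∂(Kernel.traj (X := fun _ => X) κ a h),
      ∀ᵐ c ∂(κ b (frestrictLe b ρ)), (frestrictLe (π := fun _ => X) b ρ, c) ∈ s) :
    ∀ᵐ ρ ∂(Kernel.traj (X := fun _ => X) κ a h),
      (frestrictLe (π := fun _ => X) b ρ, ρ (b + 1)) ∈ s := by
  have hm : Measurable (fun ρ : ℕ → X => (frestrictLe (π := fun _ => X) b ρ, ρ (b + 1))) := by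
    fun_prop
  refine ae_of_ae_map hm.aemeasurable (p := (· ∈ s)) ?_
  rw [← Kernel.partialTraj_compProd_eq_map_traj (X := fun _ => X) hab]
  refine (Measure.ae_compProd_iff hs).2 ?_
  rw [← Kernel.traj_map_frestrictLe_apply (X := fun _ => X) a b h]
  refine (ae_map_iff (by fun_prop) ?_).2 H
  exact (Kernel.measurable_kernel_prodMk_left (κ := κ b) hs.compl) (measurableSet_singleton 0)

/-- The Markov property: a trajectory continues, after any time `b`, like a trajectory started with
its own initial segment. -/
theorem ae_traj_of_ae_ae_traj (hab : a ≤ b) (h : Finset.Iic a → X) {s : Set (ℕ → X)}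
    (hs : MeasurableSet s)
    (H : ∀ᵐ ρ ∂(Kernel.traj (X := fun _ => X) κ a h),
      ∀ᵐ ρ' ∂(Kernel.traj (X := fun _ => X) κ b (frestrictLe b ρ)), ρ' ∈ s) :
    ∀ᵐ ρ ∂(Kernel.traj (X := fun _ => X) κ a h), ρ ∈ s := by
  rw [← Kernel.traj_comp_partialTraj (X := fun _ => X) hab, Kernel.comp_apply]
  refine Measure.ae_comp_of_ae_ae hs ?_
  rw [← Kernel.traj_map_frestrictLe_apply (X := fun _ => X) a b h]
  refine (ae_map_iff (by fun_prop) ?_).2 H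
  exact (Kernel.measurable_coe (Kernel.traj (X := fun _ => X) κ b) hs.compl)
    (measurableSet_singleton 0)

theorem ae_traj_frestrictLe_eq [MeasurableSingletonClass X] (h : Finset.Iic a → X) :
    ∀ᵐ ρ ∂(Kernel.traj (X := fun _ => X) κ a h), frestrictLe a ρ = h := by
  refine ae_of_ae_map (f := frestrictLe (π := fun _ => X) a) (by fun_prop) (p := (· = h)) ?_
  rw [Kernel.traj_map_frestrictLe_apply (X := fun _ => X) a a h, Kernel.partialTraj_self,
    Kernel.id_apply]
  simp [ae_dirac_eq]

end Trajectories

/-! ### One step of a probabilistic control flow graph -/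

namespace Node

variable {L : Type} {n : ℕ}

section Meas
variable [MeasurableSpace L] [MeasurableSingletonClass L]

theorem measurableSet_succ (v : Node L n) :
    MeasurableSet {q : Val n × Conf L n | v.Succ q.1 q.2} := by
  have heq : ∀ (t : L) {g : Val n × Conf L n → Val n}, Measurable g →
      MeasurableSet {q : Val n × Conf L n | q.2 = (t, g q)} := by
    intro t g hg
    simp only [Prod.ext_iff]
    exact ((measurable_fst.comp measurable_snd) (measurableSet_singleton t)).inter
      (measurableSet_eq_fun (measurable_snd.comp measurable_snd) hg)
  have hupd : ∀ (j : Fin n) (t : L) {D : Set ℝ}, MeasurableSet D →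
      MeasurableSet {q : Val n × Conf L n | ∃ a ∈ D, q.2 = (t, Function.update q.1 j a)} := by
    intro j t D hD
    have hj : Measurable fun q : Val n × Conf L n => q.2.2 j := by fun_prop
    have : {q : Val n × Conf L n | ∃ a ∈ D, q.2 = (t, Function.update q.1 j a)} =
        {q | q.2.2 j ∈ D} ∩ {q | q.2 = (t, Function.update q.1 j (q.2.2 j))} := by
      ext ⟨x, ℓ, y⟩
      constructor
      · rintro ⟨a, ha, h⟩
        obtain ⟨h₁, h₂⟩ := Prod.mk.inj h
        dsimp only at h₁ h₂
        subst h₁ h₂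
        simpa using ha
      · rintro ⟨h₁, h₂⟩
        exact ⟨_, h₁, h₂⟩
    rw [this]
    exact (hj hD).inter
      (heq t (measurable_update'.comp (measurable_fst.prodMk hj)))
  rcases v with t | ⟨φ, t₁, t₂⟩ | ⟨t₁, t₂⟩ | ⟨p, t₁, t₂⟩ | ⟨j, u, t⟩
  · exact heq t measurable_fst
  · exact ((measurable_fst φ.2).inter (heq t₁ measurable_fst)).union
      ((measurable_fst φ.2).compl.inter (heq t₂ measurable_fst))
  · exact (heq t₁ measurable_fst).union (heq t₂ measurable_fst)
  · exact (heq t₁ measurable_fst).union (heq t₂ measurable_fst)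
  · rcases u with f | d | ⟨D, hD, hne⟩
    · exact heq t (measurable_update'.comp (measurable_fst.prodMk (f.2.comp measurable_fst)))
    · exact hupd j t Measure.isClosed_support.measurableSet
    · exact hupd j t hD

theorem ae_law_succ (ν : Measure (Conf L n)) (v : Node L n) (x : Val n)
    (hν : v.Nondet → ∀ᵐ c ∂ν, v.Succ x c) : ∀ᵐ c ∂(v.law ν x), v.Succ x c := by
  have hs : MeasurableSet {c | v.Succ x c} := measurable_prodMk_left v.measurableSet_succ
  rcases v with t | ⟨φ, t₁, t₂⟩ | ⟨t₁, t₂⟩ | ⟨p, t₁, t₂⟩ | ⟨j, u, t⟩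
  · simp [law, Succ, ae_dirac_eq]
  · by_cases h : x ∈ φ.1 <;> simp [law, Succ, h, ae_dirac_eq]
  · exact hν trivial
  · refine ae_add_measure_iff.2 ⟨?_, ?_⟩ <;> refine Measure.ae_smul_measure ?_ _ <;>
      simp [Succ, ae_dirac_eq]
  · rcases u with f | d | ⟨D, hD, hne⟩
    · simp [law, Succ, ae_dirac_eq]
    · refine (ae_map_iff (measurable_const.prodMk (measurable_update x)).aemeasurable hs).2 ?_
      filter_upwards [Measure.support_mem_ae (μ := (d : Measure ℝ))] with a ha
      exact ⟨a, ha, rfl⟩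
    · exact hν trivial

/-- If `η` is ranked at a location and non-negative at the possible successors, then the bound `r`
is non-negative and the expected value of `η` after the next step is at most `r`, even as a Lebesgue
integral of a function with values in `[0, ∞]`. -/
theorem Ranked.lintegral_law_le {η : L → Val n → ℝ} (hη : ∀ ℓ, Measurable (η ℓ)) {r : ℝ}
    {v : Node L n} {x : Val n} (hr : v.Ranked η r x)
    (hpos : ∀ c, v.Succ x c → 0 ≤ η c.1 c.2) (ν : Measure (Conf L n)) [IsProbabilityMeasure ν]
    (hν : v.Nondet → ∀ᵐ c ∂ν, v.Succ x c) [Countable L] :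
    0 ≤ r ∧ ∫⁻ c, ENNReal.ofReal (η c.1 c.2) ∂(v.law ν x) ≤ ENNReal.ofReal r := by
  have hν' : (∀ᵐ c ∂ν, η c.1 c.2 ≤ r) →
      ∫⁻ c, ENNReal.ofReal (η c.1 c.2) ∂ν ≤ ENNReal.ofReal r := fun h =>
    (lintegral_mono_ae (h.mono fun c hc => ENNReal.ofReal_le_ofReal hc)).trans (by simp)
  rcases v with t | ⟨φ, t₁, t₂⟩ | ⟨t₁, t₂⟩ | ⟨p, t₁, t₂⟩ | ⟨j, u, t⟩
  · refine ⟨(hpos _ rfl).trans hr, ?_⟩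
    simpa [law] using ENNReal.ofReal_le_ofReal hr
  · by_cases h : x ∈ φ.1
    · refine ⟨(hpos _ (.inl ⟨h, rfl⟩)).trans (hr.1 h), ?_⟩
      simpa [law, h] using ENNReal.ofReal_le_ofReal (hr.1 h)
    · refine ⟨(hpos _ (.inr ⟨h, rfl⟩)).trans (hr.2 h), ?_⟩
      simpa [law, h] using ENNReal.ofReal_le_ofReal (hr.2 h)
  · refine ⟨(hpos _ (.inl rfl)).trans hr.1, hν' ?_⟩
    filter_upwards [hν trivial] with c hc
    rcases hc with rfl | rfl
    exacts [hr.1, hr.2]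
  · have h₁ := hpos _ (.inl rfl)
    have h₂ := hpos _ (.inr rfl)
    have hp₀ : 0 ≤ (p : ℝ) := p.2.1
    have hp₁ : 0 ≤ 1 - (p : ℝ) := sub_nonneg.2 p.2.2
    refine ⟨le_trans (by positivity) hr, ?_⟩
    simp only [law, lintegral_add_measure, lintegral_smul_measure, lintegral_dirac, smul_eq_mul]
    rw [← ENNReal.ofReal_mul hp₀, ← ENNReal.ofReal_mul hp₁, ← ENNReal.ofReal_add (by positivity)
      (by positivity)]
    exact ENNReal.ofReal_le_ofReal hr
  · rcases u with f | d | ⟨D, hD, hne⟩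
    · refine ⟨(hpos _ rfl).trans hr, ?_⟩
      simpa [law] using ENNReal.ofReal_le_ofReal hr
    · have hae : ∀ᵐ a ∂(d : Measure ℝ), 0 ≤ η t (Function.update x j a) := by
        filter_upwards [Measure.support_mem_ae (μ := (d : Measure ℝ))] with a ha
        exact hpos _ ⟨a, ha, rfl⟩
      refine ⟨(integral_nonneg_of_ae hae).trans hr.2, ?_⟩
      have hη' : Measurable fun c : Conf L n => η c.1 c.2 :=
        measurable_from_prod_countable_right hη
      simp only [law]
      rw [lintegral_map hη'.ennreal_ofReal (measurable_const.prodMk (measurable_update x)),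
        ← ofReal_integral_eq_lintegral_ofReal hr.1 hae]
      exact ENNReal.ofReal_le_ofReal hr.2
    · obtain ⟨a, ha⟩ := hne
      refine ⟨(hpos _ ⟨a, ha, rfl⟩).trans (hr a ha), hν' ?_⟩
      filter_upwards [hν trivial] with c hc
      obtain ⟨b, hb, rfl⟩ := hc
      exact hr b hb

end Meas

theorem Ranked.mono {η : L → Val n → ℝ} {r r' : ℝ} (h : r ≤ r') {v : Node L n} {x : Val n}
    (hr : v.Ranked η r x) : v.Ranked η r' x := by
  rcases v with t | ⟨φ, t₁, t₂⟩ | ⟨t₁, t₂⟩ | ⟨p, t₁, t₂⟩ | ⟨j, u | u | u, t⟩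
  · exact le_trans hr h
  · exact ⟨fun hx => (hr.1 hx).trans h, fun hx => (hr.2 hx).trans h⟩
  · exact ⟨hr.1.trans h, hr.2.trans h⟩
  · exact le_trans hr h
  · exact le_trans hr h
  · exact ⟨hr.1, hr.2.trans h⟩
  · exact fun a ha => (hr a ha).trans h

/-! ### Renaming of locations -/

theorem map_map {L' L'' : Type} (f : L → L') (g : L' → L'') (v : Node L n) :
    (v.map f).map g = v.map (g ∘ f) := by
  cases v <;> rfl

theorem nondet_map {L' : Type} (f : L → L') (v : Node L n) : (v.map f).Nondet ↔ v.Nondet := by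
  rcases v with t | ⟨φ, t₁, t₂⟩ | ⟨t₁, t₂⟩ | ⟨p, t₁, t₂⟩ | ⟨j, u | u | u, t⟩ <;> rfl

theorem succ_map_iff {L' : Type} (f : L → L') (v : Node L n) (x : Val n) (c : Conf L' n) :
    (v.map f).Succ x c ↔ ∃ c', v.Succ x c' ∧ c = Prod.map f id c' := by
  rcases v with t | ⟨φ, t₁, t₂⟩ | ⟨t₁, t₂⟩ | ⟨p, t₁, t₂⟩ | ⟨j, u | u | u, t⟩ <;>
    simp only [map, Succ] <;> constructor
  case branch.mp | ndbranch.mp | pbranch.mp =>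
    rintro (h | h)
    · exact ⟨(t₁, x), by simp_all⟩
    · exact ⟨(t₂, x), by simp_all⟩
  case jump.mp | assign.expr.mp | assign.sample.mp | assign.ndet.mp =>
    intro h
    aesop
  all_goals
    rintro ⟨c', h, rfl⟩
    aesop

theorem law_map {L' : Type} [MeasurableSpace L] [DiscreteMeasurableSpace L] [Countable L]
    [MeasurableSpace L'] [DiscreteMeasurableSpace L'] {f : L → L'} {g : L' → L}
    (hgf : Function.LeftInverse g f) [Countable L'] (v : Node L n) (ν : Measure (Conf L' n))
    (x : Val n) :
    v.law (ν.map (Prod.map g id)) x = ((v.map f).law ν x).map (Prod.map g id) := by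
  have hg : Measurable (Prod.map g (id : Val n → Val n)) :=
    (Measurable.of_discrete).prodMap measurable_id
  rcases v with t | ⟨φ, t₁, t₂⟩ | ⟨t₁, t₂⟩ | ⟨p, t₁, t₂⟩ | ⟨j, u | u | u, t⟩
  · simp [map, law, Measure.map_dirac' hg, hgf t]
  · by_cases h : x ∈ φ.1 <;> simp [map, law, Measure.map_dirac' hg, h, hgf t₁, hgf t₂]
  · rfl
  · simp [map, law, Measure.map_add _ _ hg, Measure.map_smul, Measure.map_dirac' hg, hgf t₁, hgf t₂]
  · simp [map, law, Measure.map_dirac' hg, hgf t]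
  · simp only [map, law]
    rw [Measure.map_map hg (measurable_const.prodMk (measurable_update x))]
    congr 1
    ext1 a
    simp [hgf t]
  · rfl

end Node

/-! ### Runs follow the successor relation -/

namespace PCFG

variable {L : Type} {n : ℕ} {C : PCFG L n} {S : Set (Conf L n)}

theorem IsPath.reachable {k : ℕ} {h : Hist L n k} (hh : C.IsPath S h) :
    C.Reachable S h.last := by
  have key : ∀ i (hi : i ≤ k), C.Reachable S (h ⟨i, Finset.mem_Iic.2 hi⟩) := by
    intro i
    induction i with
    | zero => exact fun hi => ⟨_, hh.1, .refl⟩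
    | succ i ih =>
      intro hi
      obtain ⟨c₀, hc₀, hr⟩ := ih (Nat.le_of_succ_le hi)
      exact ⟨c₀, hc₀, hr.tail (hh.2 i hi)⟩
  exact key k le_rfl

variable [MeasurableSpace L] [DiscreteMeasurableSpace L] [Finite L]

theorem measurableSet_succ : MeasurableSet {q : Conf L n × Conf L n | C.Succ q.1 q.2} := by
  have : {q : Conf L n × Conf L n | C.Succ q.1 q.2} =
      ⋃ ℓ, {q | q.1.1 = ℓ} ∩ {q | (C.node ℓ).Succ q.1.2 q.2} := by
    ext q
    simp [Succ]
  rw [this]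
  refine MeasurableSet.iUnion fun ℓ => MeasurableSet.inter ?_ ?_
  · exact (measurable_fst.comp measurable_fst) (measurableSet_singleton ℓ)
  · exact ((measurable_snd.comp measurable_fst).prodMk measurable_snd) (C.node ℓ).measurableSet_succ

theorem ae_step_succ (σ : C.Scheduler S) {k : ℕ} {h : Hist L n k} (hh : C.IsPath S h) :
    ∀ᵐ c ∂(step σ k h), C.Succ h.last c :=
  Node.ae_law_succ _ _ _ (σ.supported k h hh)

/-- Almost every run is an infinite path. -/
theorem ae_isPath (σ : C.Scheduler S) {c : Conf L n} (hc : c ∈ S) :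
    ∀ᵐ ρ ∂(runMeasure σ c), ∀ k, C.IsPath S (frestrictLe (π := fun _ => Conf L n) k ρ) := by
  refine ae_all_iff.2 fun k => ?_
  induction k with
  | zero =>
    filter_upwards [ae_traj_frestrictLe_eq (κ := step σ) (a := 0) (fun _ => c)] with ρ hρ
    exact ⟨by rw [hρ]; exact hc, fun i hi => absurd hi (Nat.not_lt_zero i)⟩
  | succ k ih =>
    have hs : MeasurableSet {q : Hist L n k × Conf L n | C.Succ q.1.last q.2} :=
      ((measurable_last.comp measurable_fst).prodMk measurable_snd) C.measurableSet_succ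
    have := ae_traj_succ (κ := step σ) (Nat.zero_le k) (fun _ => c) hs
      (ih.mono fun ρ hρ => ae_step_succ σ hρ)
    filter_upwards [ih, this] with ρ hρ hρ'
    refine ⟨hρ.1, fun i hi => ?_⟩
    rcases Nat.lt_succ_iff_lt_or_eq.1 hi with hi | rfl
    · exact hρ.2 i hi
    · exact hρ'

end PCFG

/-! ### Statements embedded in a control flow graph -/

namespace Stmt

variable {n : ℕ} {L : Type}

/-- The map on locations that is `e` at the points of a statement and sends the location after the
statement to `t`. -/
def Loc.lift {S : Stmt n} (e : S.Pos → L) (t : L) : S.Loc → L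
  | .pt p => e p
  | .out => t

open Classical in
/-- The map on locations that inverts `e` on its range and is `out` elsewhere. -/
def Loc.unlift {S : Stmt n} (e : S.Pos → L) : L → S.Loc :=
  Function.extend e Loc.pt fun _ => .out

/-- The control flow graph `C` contains a copy of the statement `S`: the points of `S` are located
in `C` by `e`, and the execution of `S` is left through the location `t`. -/
structure Embeds (C : PCFG L n) (S : Stmt n) (e : S.Pos → L) (t : L) : Prop where
  injective : Function.Injective e
  exit : ∀ p, e p ≠ t
  node_eq : ∀ p, C.node (e p) = (Stmt.node p).map (Loc.lift e t)

namespace Embeds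

variable {C : PCFG L n} {S : Stmt n} {e : S.Pos → L} {t : L}

theorem unlift_apply (hE : Embeds C S e t) (p : S.Pos) : Loc.unlift e (e p) = .pt p :=
  hE.injective.extend_apply _ _ _

theorem unlift_of_notMem {ℓ : L} (hℓ : ℓ ∉ Set.range e) : Loc.unlift e ℓ = .out :=
  Function.extend_apply' _ _ _ hℓ

theorem leftInverse (hE : Embeds C S e t) :
    Function.LeftInverse (Loc.unlift e) (Loc.lift e t) := by
  rintro (p | _)
  · exact hE.unlift_apply p
  · exact unlift_of_notMem fun ⟨p, hp⟩ => hE.exit p hp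

theorem lift_unlift (hE : Embeds C S e t) {ℓ : L} (hℓ : ℓ ∈ Set.range e) :
    Loc.lift e t (Loc.unlift e ℓ) = ℓ := by
  obtain ⟨p, rfl⟩ := hℓ
  rw [hE.unlift_apply]
  rfl

theorem lift_mem_range (hE : Embeds C S e t) {ℓ : S.Loc} :
    Loc.lift e t ℓ ∈ Set.range e ↔ ∃ p, ℓ = .pt p := by
  rcases ℓ with p | _
  · exact ⟨fun _ => ⟨p, rfl⟩, fun _ => ⟨p, rfl⟩⟩
  · exact ⟨fun ⟨p, hp⟩ => absurd hp (hE.exit p), by simp⟩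

theorem succ (hE : Embeds C S e t) {p : S.Pos} {x : Val n} {c : Conf S.Loc n}
    (h : S.pcfg.Succ (.pt p, x) c) : C.Succ (e p, x) (Prod.map (Loc.lift e t) id c) := by
  unfold PCFG.Succ
  rw [hE.node_eq]
  exact (Node.succ_map_iff _ _ _ _).2 ⟨c, h, rfl⟩

theorem exists_succ (hE : Embeds C S e t) {p : S.Pos} {x : Val n} {c : Conf L n}
    (h : C.Succ (e p, x) c) :
    ∃ c', S.pcfg.Succ (.pt p, x) c' ∧ c = Prod.map (Loc.lift e t) id c' := by
  unfold PCFG.Succ at h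
  rw [hE.node_eq] at h
  exact (Node.succ_map_iff _ _ _ _).1 h

theorem succ_unlift (hE : Embeds C S e t) {p : S.Pos} {x : Val n} {c : Conf L n}
    (h : C.Succ (e p, x) c) : S.pcfg.Succ (.pt p, x) (Prod.map (Loc.unlift e) id c) := by
  obtain ⟨c', h', rfl⟩ := hE.exists_succ h
  simpa [Prod.map_map, hE.leftInverse.comp_eq_id] using h'

end Embeds

/-- In a path of the control flow graph of `S`, all configurations before a point of `S` are at
points of `S`: the terminal location cannot be left. -/
theorem exists_pt_of_isPath {S : Stmt n} {A : Set (Conf S.Loc n)} {k : ℕ} {h : PCFG.Hist S.Loc n k}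
    (hh : S.pcfg.IsPath A h) {p : S.Pos} (hp : h.last.1 = .pt p) (i : ℕ) (hi : i ≤ k) :
    ∃ q, (h ⟨i, Finset.mem_Iic.2 hi⟩).1 = .pt q := by
  induction hi using Nat.decreasingInduction with
  | self => exact ⟨p, hp⟩
  | of_succ j hj ih =>
    obtain ⟨q, hq⟩ := ih
    rcases hc : h ⟨j, Finset.mem_Iic.2 hj.le⟩ with ⟨r | _, x⟩
    · exact ⟨r, rfl⟩
    · have := hh.2 j hj
      rw [hc] at this
      change _ = _ at this
      rw [this] at hq
      cases hq

end Stmt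

/-! ### Concatenation of sequences of configurations -/

namespace PCFG

open Stmt

variable {n : ℕ} {L : Type}

/-- The sequence `h` up to time `m - 1`, followed by the copy in the surrounding graph of a sequence
of configurations of the statement. The last entry of `h` is thus replaced by the copy of the first
entry of `h'`. The truncation `min i m` only serves to stay in the domain of `h` without a proof. -/
def Hist.append {S : Stmt n} (e : S.Pos → L) (t : L) {m k : ℕ} (h : Hist L n m)
    (h' : Hist S.Loc n k) : Hist L n (m + k) := fun i =>
  if i.1 < m then h ⟨min i m, Finset.mem_Iic.2 (min_le_right _ _)⟩
  else Prod.map (Loc.lift e t) id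
    (h' ⟨i - m, Finset.mem_Iic.2 (Nat.sub_le_iff_le_add'.2 (Finset.mem_Iic.1 i.2))⟩)

/-- A sequence of configurations, followed by one more configuration. The index is truncated as in
`Hist.append`. -/
def Hist.snoc {k : ℕ} (h : Hist L n k) (c : Conf L n) : Hist L n (k + 1) := fun i =>
  if i.1 ≤ k then h ⟨min i k, Finset.mem_Iic.2 (min_le_right _ _)⟩ else c

theorem Hist.snoc_frestrictLe (ρ : ℕ → Conf L n) (k : ℕ) :
    Hist.snoc (frestrictLe (π := fun _ => Conf L n) k ρ) (ρ (k + 1)) =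
      frestrictLe (π := fun _ => Conf L n) (k + 1) ρ := by
  funext ⟨i, hi⟩
  have hi' := Finset.mem_Iic.1 hi
  unfold Hist.snoc
  split_ifs with h
  · simp only [frestrictLe_apply, min_eq_left h]
  · obtain rfl : i = k + 1 := by simp only at h; omega
    rfl

theorem Hist.last_append {S : Stmt n} (e : S.Pos → L) (t : L) {m k : ℕ} (h : Hist L n m)
    (h' : Hist S.Loc n k) :
    Hist.last (Hist.append e t h h') = Prod.map (Loc.lift e t) id h'.last := by
  simp [Hist.append, Hist.last]

theorem Hist.snoc_append {S : Stmt n} (e : S.Pos → L) (t : L) {m k : ℕ} (h : Hist L n m)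
    (h' : Hist S.Loc n k) (c : Conf S.Loc n) :
    Hist.snoc (Hist.append e t h h') (Prod.map (Loc.lift e t) id c) =
      Hist.append e t h (Hist.snoc h' c) := by
  funext ⟨i, hi⟩
  have hi' := Finset.mem_Iic.1 hi
  simp only [Hist.snoc, Hist.append]
  by_cases h₁ : i ≤ m + k
  · by_cases h₂ : i < m
    · have h₃ : min i m = i := by omega
      simp [h₁, h₂]
    · have h₃ : i - m ≤ k := by omega
      simp [h₁, h₂, h₃]
  · have h₂ : ¬ i < m := by omega
    have h₃ : ¬ i - m ≤ k := by omega
    simp [h₁, h₂, h₃]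

section Meas

variable [MeasurableSpace L]

theorem Hist.measurable_snoc {k : ℕ} :
    Measurable fun q : Hist L n k × Conf L n => Hist.snoc q.1 q.2 := by
  refine measurable_pi_lambda _ fun i => ?_
  unfold Hist.snoc
  split_ifs
  · exact (measurable_pi_apply _).comp measurable_fst
  · exact measurable_snd

theorem Hist.measurable_append {S : Stmt n} (e : S.Pos → L) (t : L) {m k : ℕ} (h : Hist L n m) :
    Measurable fun h' : Hist S.Loc n k => Hist.append e t h h' := by
  refine measurable_pi_lambda _ fun i => ?_
  unfold Hist.append
  split_ifs
  · exact measurable_const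
  · exact (Measurable.prodMap .of_discrete measurable_id).comp (measurable_pi_apply _)

end Meas

end PCFG

/-! ### Runs inside an embedded statement -/

namespace Stmt

open PCFG

variable {n : ℕ} {L : Type}

theorem measurable_unlift [MeasurableSpace L] [DiscreteMeasurableSpace L] {S : Stmt n}
    (e : S.Pos → L) : Measurable (Prod.map (Loc.unlift e) id : Conf L n → Conf S.Loc n) :=
  Measurable.prodMap .of_discrete measurable_id

theorem Embeds.isPath_append {C : PCFG L n} {S : Stmt n} {e : S.Pos → L} {t : L}
    (hE : Embeds C S e t) {A : Set (Conf L n)} {m k : ℕ} {h : Hist L n m} (hh : C.IsPath A h)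
    {x : Val n} (hx : h.last = (e S.entry, x)) {A' : Set (Conf S.Loc n)}
    (hA' : A' ⊆ {(.pt S.entry, x)}) {h' : Hist S.Loc n k} (hh' : S.pcfg.IsPath A' h')
    {p : S.Pos} (hp : h'.last.1 = .pt p) : C.IsPath A (Hist.append e t h h') := by
  have h₀ : h' ⟨0, Finset.mem_Iic.2 (Nat.zero_le k)⟩ = (.pt S.entry, x) := hA' hh'.1
  -- up to time `m`, the appended sequence agrees with `h`
  have hle : ∀ i (hi : i ≤ m) (hi' : i ∈ Finset.Iic (m + k)),
      Hist.append e t h h' ⟨i, hi'⟩ = h ⟨i, Finset.mem_Iic.2 hi⟩ := by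
    intro i hi hi'
    unfold Hist.append
    split_ifs with h₁
    · simp only [min_eq_left hi]
    · obtain rfl : i = m := by simp only at h₁; omega
      simp only [Nat.sub_self, h₀]
      exact hx.symm
  have hge : ∀ i (hi : i ≤ k) (hi' : m + i ∈ Finset.Iic (m + k)),
      Hist.append e t h h' ⟨m + i, hi'⟩ =
        Prod.map (Loc.lift e t) id (h' ⟨i, Finset.mem_Iic.2 hi⟩) := by
    intro i hi hi'
    simp [Hist.append]
  refine ⟨by rw [hle 0 (Nat.zero_le m)]; exact hh.1, fun i hi => ?_⟩
  rcases Nat.lt_or_ge i m with him | him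
  · rw [hle i him.le, hle (i + 1) him]
    exact hh.2 i him
  · obtain ⟨j, rfl⟩ := Nat.exists_eq_add_of_le him
    have hj : j < k := by omega
    obtain ⟨q, hq⟩ := exists_pt_of_isPath hh' hp j hj.le
    have hs := hh'.2 j hj
    rw [hge j hj.le]
    have := hge (j + 1) hj (Finset.mem_Iic.2 hi)
    refine (congrArg _ this).mpr ?_
    rw [← Prod.mk.eta (p := h' ⟨j, _⟩), hq] at hs ⊢
    exact hE.succ hs

variable [MeasurableSpace L] [DiscreteMeasurableSpace L] [Finite L]

/-- A scheduler for the surrounding graph, and a path that ends at the entry of an embedded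
statement, determine a scheduler for that statement: its choices are those of the given scheduler
after that path. -/
def Embeds.scheduler {C : PCFG L n} {S : Stmt n} {e : S.Pos → L} {t : L}
    (hE : Embeds C S e t) {A : Set (Conf L n)} (σ : C.Scheduler A) {m : ℕ} {h : Hist L n m}
    (hh : C.IsPath A h) {x : Val n} (hx : h.last = (e S.entry, x)) :
    S.pcfg.Scheduler (Program.mk ⟨{x}, measurableSet_singleton x⟩ S).initConfs where
  choice k := ((σ.choice (m + k)).comap _ (Hist.measurable_append e t h)).map
    (Prod.map (Loc.unlift e) id)
  markov k := Kernel.IsMarkovKernel.map _ (measurable_unlift e)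
  supported k h' hh' hnd := by
    have hs : MeasurableSet {c | S.pcfg.Succ h'.last c} :=
      measurable_prodMk_left S.pcfg.measurableSet_succ
    rw [Kernel.map_apply _ (measurable_unlift e), ae_map_iff (measurable_unlift e).aemeasurable hs,
      Kernel.comap_apply]
    obtain ⟨p, hp⟩ : ∃ p, h'.last.1 = .pt p := by
      rcases hc : h'.last.1 with p | _
      · exact ⟨p, rfl⟩
      · rw [hc] at hnd
        exact hnd.elim
    have hpath := hE.isPath_append hh hx (fun c hc => Prod.ext hc.1 hc.2) hh' hp
    have hlast : Hist.last (Hist.append e t h h') = (e p, h'.last.2) := by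
      rw [Hist.last_append]
      exact Prod.ext (by simp [hp, Loc.lift]) rfl
    have hl' : h'.last = (.pt p, h'.last.2) := Prod.ext hp rfl
    have hnd' : (C.node (Hist.last (Hist.append e t h h')).1).Nondet := by
      rw [hlast, hE.node_eq, Node.nondet_map]
      rw [hp] at hnd
      exact hnd
    filter_upwards [σ.supported _ _ hpath hnd'] with c hc
    rw [hlast] at hc
    rw [hl']
    exact hE.succ_unlift hc

theorem Embeds.step_scheduler {C : PCFG L n} {S : Stmt n} {e : S.Pos → L} {t : L}
    (hE : Embeds C S e t) {A : Set (Conf L n)} (σ : C.Scheduler A) {m : ℕ} {h : Hist L n m}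
    (hh : C.IsPath A h) {x : Val n} (hx : h.last = (e S.entry, x)) {k : ℕ} {h' : Hist S.Loc n k}
    {p : S.Pos} (hp : h'.last.1 = .pt p) :
    step (hE.scheduler σ hh hx) k h' =
      (step σ (m + k) (Hist.append e t h h')).map (Prod.map (Loc.unlift e) id) := by
  change (S.pcfg.node h'.last.1).law ((hE.scheduler σ hh hx).choice k h') h'.last.2 =
    ((C.node (Hist.last (Hist.append e t h h')).1).law (σ.choice (m + k) (Hist.append e t h h'))
      (Hist.last (Hist.append e t h h')).2).map _
  have hlast : Hist.last (Hist.append e t h h') = (e p, h'.last.2) := by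
    rw [Hist.last_append]
    exact Prod.ext (by simp [hp, Loc.lift]) rfl
  have hc : (hE.scheduler σ hh hx).choice k h' =
      (σ.choice (m + k) (Hist.append e t h h')).map (Prod.map (Loc.unlift e) id) := by
    simp only [Embeds.scheduler]
    rw [Kernel.map_apply _ (measurable_unlift e), Kernel.comap_apply]
  rw [hc, hlast, hp, hE.node_eq]
  exact Node.law_map hE.leftInverse _ _ _

/-- As long as a run that enters an embedded statement stays inside it, it is distributed like a run
of the statement as a program of its own. Only the inequality that bounds the time spent inside the
statement is stated. -/
theorem Embeds.lintegral_traj_le {C : PCFG L n} {S : Stmt n} {e : S.Pos → L} {t : L}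
    (hE : Embeds C S e t) {A : Set (Conf L n)} (σ : C.Scheduler A) {m : ℕ} {h : Hist L n m}
    (hh : C.IsPath A h) {x : Val n} (hx : h.last = (e S.entry, x)) (k : ℕ)
    {g : Hist L n (m + k) → ℝ≥0∞} (hg : Measurable g)
    (hg₀ : ∀ h'', ∀ i : Finset.Iic (m + k), m ≤ i → (h'' i).1 ∉ Set.range e → g h'' = 0) :
    ∫⁻ ρ, g (frestrictLe (π := fun _ => Conf L n) (m + k) ρ)
        ∂(Kernel.traj (X := fun _ => Conf L n) (step σ) m h) ≤
      ∫⁻ ρ, g (Hist.append e t h (frestrictLe (π := fun _ => Conf S.Loc n) k ρ))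
        ∂(runMeasure (hE.scheduler σ hh hx) (.pt S.entry, x)) := by
  induction k with
  | zero =>
    have h₁ : ∀ᵐ ρ ∂(Kernel.traj (X := fun _ => Conf L n) (step σ) m h),
        g (frestrictLe (π := fun _ => Conf L n) (m + 0) ρ) = g h := by
      filter_upwards [ae_traj_frestrictLe_eq (κ := step σ) h] with ρ hρ
      exact congrArg g hρ
    have h₂ : ∀ᵐ ρ ∂(runMeasure (hE.scheduler σ hh hx) (.pt S.entry, x)),
        g (Hist.append e t h (frestrictLe (π := fun _ => Conf S.Loc n) 0 ρ)) = g h := by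
      filter_upwards [ae_traj_frestrictLe_eq (κ := step (hE.scheduler σ hh hx)) (a := 0)
        (fun _ => (.pt S.entry, x))] with ρ hρ
      rw [hρ]
      congr 1
      funext ⟨i, hi⟩
      have hi' : i ≤ m := Finset.mem_Iic.1 hi
      unfold Hist.append
      split_ifs with h₁
      · simp only [min_eq_left hi']
      · obtain rfl : i = m := by simp only at h₁; omega
        exact hx.symm
    have : IsProbabilityMeasure (runMeasure (hE.scheduler σ hh hx) (.pt S.entry, x)) := by
      unfold runMeasure; infer_instance
    rw [lintegral_congr_ae h₁, lintegral_congr_ae h₂]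
    simp
  | succ k ih =>
    have hF : Measurable fun q : Hist L n (m + k) × Conf L n => g (Hist.snoc q.1 q.2) :=
      hg.comp Hist.measurable_snoc
    have hF' : Measurable fun q : Hist S.Loc n k × Conf S.Loc n =>
        g (Hist.append e t h (Hist.snoc q.1 q.2)) :=
      hg.comp ((Hist.measurable_append e t h).comp Hist.measurable_snoc)
    have hsn : ∀ h'' c, c.1 ∉ Set.range e → g (Hist.snoc h'' c) = 0 := fun h'' c hc =>
      hg₀ _ ⟨m + k + 1, Finset.mem_Iic.2 le_rfl⟩ (by simp only; omega) (by simpa [Hist.snoc] using hc)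
    calc ∫⁻ ρ, g (frestrictLe (π := fun _ => Conf L n) (m + (k + 1)) ρ)
          ∂(Kernel.traj (X := fun _ => Conf L n) (step σ) m h)
        = ∫⁻ ρ, g (Hist.snoc (frestrictLe (π := fun _ => Conf L n) (m + k) ρ) (ρ (m + k + 1)))
          ∂(Kernel.traj (X := fun _ => Conf L n) (step σ) m h) :=
          lintegral_congr fun ρ => congrArg g (Hist.snoc_frestrictLe ρ (m + k)).symm
      _ = ∫⁻ ρ, ∫⁻ c, g (Hist.snoc (frestrictLe (π := fun _ => Conf L n) (m + k) ρ) c)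
            ∂(step σ (m + k) (frestrictLe (π := fun _ => Conf L n) (m + k) ρ))
          ∂(Kernel.traj (X := fun _ => Conf L n) (step σ) m h) :=
          lintegral_traj_succ (κ := step σ) (Nat.le_add_right m k) h hF
      _ ≤ ∫⁻ ρ, ∫⁻ c, g (Hist.snoc (Hist.append e t h
              (frestrictLe (π := fun _ => Conf S.Loc n) k ρ)) c)
            ∂(step σ (m + k) (Hist.append e t h (frestrictLe (π := fun _ => Conf S.Loc n) k ρ)))
          ∂(runMeasure (hE.scheduler σ hh hx) (.pt S.entry, x)) := by
          refine ih (g := fun h'' => ∫⁻ c, g (Hist.snoc h'' c) ∂(step σ (m + k) h''))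
            hF.lintegral_kernel_prod_right' fun h'' i hi hi' => ?_
          have : ∀ c, g (Hist.snoc h'' c) = 0 := fun c => by
            have hik := Finset.mem_Iic.1 i.2
            refine hg₀ _ ⟨i, Finset.mem_Iic.2 (by omega)⟩ hi ?_
            simpa [Hist.snoc, hik] using hi'
          simp [this]
      _ ≤ ∫⁻ ρ, ∫⁻ c, g (Hist.append e t h
              (Hist.snoc (frestrictLe (π := fun _ => Conf S.Loc n) k ρ) c))
            ∂(step (hE.scheduler σ hh hx) k (frestrictLe (π := fun _ => Conf S.Loc n) k ρ))
          ∂(runMeasure (hE.scheduler σ hh hx) (.pt S.entry, x)) := by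
          refine lintegral_mono fun ρ => ?_
          set h' : Hist S.Loc n k := frestrictLe (π := fun _ => Conf S.Loc n) k ρ
          rcases hp : h'.last.1 with p | _
          · have hF'' : Measurable fun c => g (Hist.append e t h (Hist.snoc h' c)) :=
              hF'.comp measurable_prodMk_left
            rw [hE.step_scheduler σ hh hx hp, lintegral_map hF'' (measurable_unlift e)]
            refine lintegral_mono fun c => ?_
            by_cases hc : c.1 ∈ Set.range e
            · rw [← Hist.snoc_append, Prod.map_map]
              have : Prod.map (Loc.lift e t ∘ Loc.unlift e) (id ∘ id) c = c :=
                Prod.ext (hE.lift_unlift hc) rfl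
              rw [this]
            · rw [hsn _ _ hc]
              exact zero_le
          · have : ∀ c, g (Hist.snoc (Hist.append e t h h') c) = 0 := fun c => by
              refine hg₀ _ ⟨m + k, Finset.mem_Iic.2 (by omega)⟩ (by simp only; omega) ?_
              have hl : Hist.snoc (Hist.append e t h h') c ⟨m + k, Finset.mem_Iic.2 (by omega)⟩ =
                  Hist.last (Hist.append e t h h') := by simp [Hist.snoc, Hist.last]
              rw [hl, Hist.last_append]
              simp [hp, hE.lift_mem_range]
            simp [this]
      _ = ∫⁻ ρ, g (Hist.append e t h (Hist.snoc (frestrictLe (π := fun _ => Conf S.Loc n) k ρ)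
            (ρ (k + 1)))) ∂(runMeasure (hE.scheduler σ hh hx) (.pt S.entry, x)) :=
          (lintegral_traj_succ (κ := step (hE.scheduler σ hh hx)) (Nat.zero_le k) _ hF').symm
      _ = _ := by simp only [Hist.snoc_frestrictLe]

end Stmt

/-! ### Leaving embedded statements -/

open PCFG

namespace Stmt

variable {n : ℕ} {L : Type} {C : PCFG L n}

section Leave

variable [MeasurableSpace L] [DiscreteMeasurableSpace L] [Finite L]

/-- If a statement terminates almost surely when it is run on its own, then almost no run of the
surrounding graph that enters its copy stays there forever. -/
theorem Embeds.ae_not_forall_mem_range {S : Stmt n} {e : S.Pos → L} {t : L}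
    (hE : Embeds C S e t) {A : Set (Conf L n)} (σ : C.Scheduler A) {c₀ : Conf L n} (hc₀ : c₀ ∈ A)
    (hT : ∀ x, C.Reachable A (e S.entry, x) →
      (Program.mk ⟨{x}, measurableSet_singleton x⟩ S).ASTerminates) (m : ℕ) :
    ∀ᵐ ρ ∂(runMeasure σ c₀), ¬((ρ m).1 = e S.entry ∧ ∀ k ≥ m, (ρ k).1 ∈ Set.range e) := by
  have hloc : ∀ k, Measurable fun ρ : ℕ → Conf L n => (ρ k).1 := fun k =>
    measurable_fst.comp (measurable_pi_apply k)
  have hms : MeasurableSet {ρ : ℕ → Conf L n |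
      ¬((ρ m).1 = e S.entry ∧ ∀ k ≥ m, (ρ k).1 ∈ Set.range e)} := by
    refine MeasurableSet.compl (((hloc m) (.of_discrete (s := {e S.entry}))).inter ?_)
    have : {ρ : ℕ → Conf L n | ∀ k ≥ m, (ρ k).1 ∈ Set.range e} =
        ⋂ k, ⋂ (_ : k ≥ m), {ρ | (ρ k).1 ∈ Set.range e} := by ext; simp
    change MeasurableSet {ρ : ℕ → Conf L n | ∀ k ≥ m, (ρ k).1 ∈ Set.range e}
    rw [this]
    exact .iInter fun k => .iInter fun _ => hloc k .of_discrete
  refine ae_traj_of_ae_ae_traj (κ := step σ) (Nat.zero_le m) _ hms ?_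
  filter_upwards [ae_isPath σ hc₀] with ρ₀ hρ₀
  set h : Hist L n m := frestrictLe (π := fun _ => Conf L n) m ρ₀
  have hh : C.IsPath A h := hρ₀ m
  by_cases hx : h.last.1 = e S.entry
  swap
  · filter_upwards [ae_traj_frestrictLe_eq (κ := step σ) h] with ρ hρ
    rintro ⟨h₁, -⟩
    exact hx (by rw [← hρ]; exact h₁)
  replace hx : h.last = (e S.entry, h.last.2) := Prod.ext hx rfl
  generalize h.last.2 = x at hx
  have hreach : C.Reachable A (e S.entry, x) := hx ▸ hh.reachable
  have hterm := hT x hreach (hE.scheduler σ hh hx) (.pt S.entry, x) ⟨rfl, rfl⟩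
  set ν := runMeasure (hE.scheduler σ hh hx) (.pt S.entry, x)
  have hν : IsProbabilityMeasure ν := by unfold ν runMeasure; infer_instance
  set U : ℕ → Set (ℕ → Conf S.Loc n) := fun k => {ρ | ∀ i ≤ k, (ρ i).1 ≠ .out}
  have hUm : ∀ k, MeasurableSet (U k) := fun k => by
    have : U k = ⋂ i, ⋂ (_ : i ≤ k), {ρ | (ρ i).1 ≠ .out} := by ext; simp [U]
    rw [this]
    exact .iInter fun i => .iInter fun _ =>
      (measurable_fst.comp (measurable_pi_apply i)) (.of_discrete (s := {(.out : S.Loc)}ᶜ))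
  have hlim : Filter.Tendsto (fun k => ν (U k)) Filter.atTop (nhds 0) := by
    have h₀ : ν (⋂ k, U k) = 0 := by
      refine measure_mono_null ?_ (ae_iff.1 hterm)
      intro ρ hρ
      simp only [Set.mem_iInter] at hρ
      rintro ⟨i, hi⟩
      exact hρ i i le_rfl hi
    rw [← h₀]
    exact tendsto_measure_iInter_atTop (fun k => (hUm k).nullMeasurableSet)
      (fun i j hij ρ hρ k hk => hρ k (hk.trans hij)) ⟨0, measure_ne_top _ _⟩
  suffices h₀ : Kernel.traj (X := fun _ => Conf L n) (step σ) m h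
      {ρ | ∀ k ≥ m, (ρ k).1 ∈ Set.range e} = 0 from
    measure_mono_null (fun ρ hρ => (not_not.1 hρ).2) h₀
  refine le_antisymm (ge_of_tendsto' hlim fun k => ?_) zero_le
  -- the probability of staying until time `m + k` is at most that of not terminating until time `k`
  set s : Set (Hist L n (m + k)) := {h'' | ∀ i, m ≤ i.1 → (h'' i).1 ∈ Set.range e}
  have hs : MeasurableSet s := by
    have : s = ⋂ i, ⋂ (_ : m ≤ i.1), {h'' | (h'' i).1 ∈ Set.range e} := by ext; simp [s]
    rw [this]
    exact .iInter fun i => .iInter fun _ =>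
      (measurable_fst.comp (measurable_pi_apply i)) (.of_discrete (s := Set.range e))
  have hle := hE.lintegral_traj_le σ hh hx k (g := s.indicator 1) (measurable_one.indicator hs)
    (fun h'' i hi hi' =>
      Set.indicator_of_notMem (fun hmem : h'' ∈ s => hi' (hmem i hi)) _)
  have h₁ : MeasurableSet ((frestrictLe (π := fun _ => Conf L n) (m + k)) ⁻¹' s) :=
    (measurable_frestrictLe _) hs
  have h₂ : MeasurableSet ((fun ρ : ℕ → Conf S.Loc n =>
      Hist.append e t h (frestrictLe (π := fun _ => Conf S.Loc n) k ρ)) ⁻¹' s) :=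
    ((Hist.measurable_append e t h).comp (measurable_frestrictLe _)) hs
  have hle' := ((lintegral_indicator_one h₁).symm.le.trans hle).trans (lintegral_indicator_one h₂).le
  refine (measure_mono ?_).trans (hle'.trans (measure_mono ?_))
  · intro ρ hρ i hi
    exact hρ i hi
  · intro ρ hρ i hi hout
    have := hρ ⟨m + i, Finset.mem_Iic.2 (by omega)⟩ (Nat.le_add_right m i)
    simp only [Hist.append, Nat.not_lt.2 (Nat.le_add_right m i), if_false, Nat.add_sub_cancel_left,
      Prod.map_fst, frestrictLe_apply, hout, hE.lift_mem_range] at this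
    obtain ⟨p, hp⟩ := this
    cases hp

end Leave

theorem Embeds.exists_succ_of_fst_eq {S : Stmt n} {e : S.Pos → L} {t : L}
    (hE : Embeds C S e t) {c d : Conf L n} {p : S.Pos} (hc : c.1 = e p) (h : C.Succ c d) :
    ∃ c', S.pcfg.Succ (.pt p, c.2) c' ∧ d.1 = Loc.lift e t c'.1 := by
  obtain ⟨c', h₁, rfl⟩ := hE.exists_succ (p := p) (x := c.2) (c := d) (by rw [← hc]; exact h)
  exact ⟨c', h₁, rfl⟩

/-- A path that leaves an embedded statement does so through the location after the statement. -/
theorem Embeds.exists_eq_exit {S : Stmt n} {e : S.Pos → L} {t : L} (hE : Embeds C S e t)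
    {ρ : ℕ → Conf L n} (hρ : ∀ k, C.Succ (ρ k) (ρ (k + 1))) {m : ℕ} (hm : (ρ m).1 ∈ Set.range e)
    (hl : ¬∀ k ≥ m, (ρ k).1 ∈ Set.range e) : ∃ k > m, (ρ k).1 = t := by
  by_contra! hno
  refine hl fun k hk => ?_
  induction k, hk using Nat.le_induction with
  | base => exact hm
  | succ k hk ih =>
    obtain ⟨p, hp⟩ := ih
    obtain ⟨c', -, hc'⟩ := hE.exists_succ_of_fst_eq hp.symm (hρ k)
    rcases c' with ⟨q | _, y⟩
    · exact ⟨q, hc'.symm⟩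
    · exact absurd hc' (hno (k + 1) (by omega))

/-- A copy of a statement contains a copy of each substatement `a`, located by `i`, where `r` sends
the location after `a` to a location of the statement outside this copy. -/
theorem Embeds.sub {S a : Stmt n} {e : S.Pos → L} {t : L} (hE : Embeds C S e t)
    {i : a.Pos → S.Pos} (hi : Function.Injective i) {r : a.Loc → S.Loc}
    (hr : ∀ p, r (.pt p) = .pt (i p)) (hout : ∀ p, .pt (i p) ≠ r .out)
    (hnode : ∀ p, Stmt.node (i p) = (Stmt.node p).map r) :
    Embeds C a (e ∘ i) (Loc.lift e t (r .out)) where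
  injective := hE.injective.comp hi
  exit p h := hout p (hE.leftInverse.injective h)
  node_eq p := by
    rw [Function.comp_apply, hE.node_eq, hnode, Node.map_map]
    congr 1
    funext ℓ
    rcases ℓ with q | _
    · exact congrArg (Loc.lift e t) (hr q)
    · rfl

theorem Embeds.seq_fst {a b : Stmt n} {e : (Stmt.seq a b).Pos → L} {t : L}
    (hE : Embeds C (.seq a b) e t) : Embeds C a (e ∘ .fst) (e (.snd b.entry)) :=
  hE.sub (fun _ _ h => by cases h; rfl)
    (r := fun | .pt q => .pt (.fst q) | .out => .pt (.snd b.entry))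
    (fun _ => rfl) (fun _ h => by cases h) (fun _ => rfl)

theorem Embeds.seq_snd {a b : Stmt n} {e : (Stmt.seq a b).Pos → L} {t : L}
    (hE : Embeds C (.seq a b) e t) : Embeds C b (e ∘ .snd) t :=
  hE.sub (fun _ _ h => by cases h; rfl) (r := fun | .pt q => .pt (.snd q) | .out => .out)
    (fun _ => rfl) (fun _ h => by cases h) (fun _ => rfl)

theorem Embeds.ite_thn {g : Guard n} {a b : Stmt n} {e : (Stmt.ite g a b).Pos → L} {t : L}
    (hE : Embeds C (.ite g a b) e t) : Embeds C a (e ∘ .thn) t :=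
  hE.sub (fun _ _ h => by cases h; rfl) (r := fun | .pt q => .pt (.thn q) | .out => .out)
    (fun _ => rfl) (fun _ h => by cases h) (fun _ => rfl)

theorem Embeds.ite_els {g : Guard n} {a b : Stmt n} {e : (Stmt.ite g a b).Pos → L} {t : L}
    (hE : Embeds C (.ite g a b) e t) : Embeds C b (e ∘ .els) t :=
  hE.sub (fun _ _ h => by cases h; rfl) (r := fun | .pt q => .pt (.els q) | .out => .out)
    (fun _ => rfl) (fun _ h => by cases h) (fun _ => rfl)

/-- The body of a loop is embedded in the control flow graph of the loop. -/
theorem embeds_body (Ψ : Pred n) (B : Stmt n) :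
    Embeds (loop Ψ B).pcfg B (fun p => .pt (.body p)) (.pt .head) where
  injective _ _ h := by cases h; rfl
  exit _ h := by cases h
  node_eq p := by
    change (Stmt.node p).map _ = _
    congr 1

/-- If the loops inside an embedded statement terminate almost surely on their own, then almost no
run that enters the statement stays there forever. -/
theorem Embeds.ae_leaves [MeasurableSpace L] [DiscreteMeasurableSpace L] [Finite L] {S : Stmt n}
    {e : S.Pos → L} {t : L} (hE : Embeds C S e t) {A : Set (Conf L n)} (σ : C.Scheduler A)
    {c₀ : Conf L n} (hc₀ : c₀ ∈ A)
    (hT : ∀ (p : S.Pos) (Φ : Pred n) (D : Stmt n), stmtAt p = .loop Φ D →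
      ∀ x, C.Reachable A (e p, x) →
        (Program.mk ⟨{x}, measurableSet_singleton x⟩ (.loop Φ D)).ASTerminates) :
    ∀ᵐ ρ ∂(runMeasure σ c₀), ∀ m, (ρ m).1 = e S.entry → ¬∀ k ≥ m, (ρ k).1 ∈ Set.range e := by
  have hsucc : ∀ᵐ ρ ∂(runMeasure σ c₀), ∀ k, C.Succ (ρ k) (ρ (k + 1)) := by
    filter_upwards [ae_isPath σ hc₀] with ρ hρ k using (hρ (k + 1)).2 k (Nat.lt_succ_self k)
  induction S generalizing t with
  | skip =>
    filter_upwards [hsucc] with ρ hρ m hm hstay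
    obtain ⟨c', h₁, h₂⟩ := hE.exists_succ_of_fst_eq hm (hρ m)
    obtain rfl : c' = (.out, (ρ m).2) := h₁
    obtain ⟨p, hp⟩ := hstay (m + 1) (Nat.le_succ m)
    exact hE.exit p (hp.trans h₂)
  | assign j u =>
    filter_upwards [hsucc] with ρ hρ m hm hstay
    obtain ⟨c', h₁, h₂⟩ := hE.exists_succ_of_fst_eq hm (hρ m)
    have hc' : c'.1 = .out := by
      rcases u with f | d | ⟨D, hD, hne⟩
      · exact congrArg Prod.fst (h₁ : c' = (.out, _))
      · obtain ⟨a, -, rfl⟩ := h₁; rfl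
      · obtain ⟨a, -, rfl⟩ := h₁; rfl
    obtain ⟨p, hp⟩ := hstay (m + 1) (Nat.le_succ m)
    rw [hc'] at h₂
    exact hE.exit p (hp.trans h₂)
  | seq a b iha ihb =>
    filter_upwards [hsucc, iha hE.seq_fst fun p => hT (.fst p),
      ihb hE.seq_snd fun p => hT (.snd p)] with ρ hρ ha hb m hm hstay
    obtain ⟨k, hk, hk'⟩ := hE.seq_fst.exists_eq_exit hρ ⟨a.entry, hm.symm⟩ (ha m hm)
    obtain ⟨l, hl, hl'⟩ := hE.seq_snd.exists_eq_exit hρ ⟨b.entry, hk'.symm⟩ (hb k hk')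
    obtain ⟨p, hp⟩ := hstay l (by omega)
    exact hE.exit p (hp.trans hl')
  | ite g a b iha ihb =>
    filter_upwards [hsucc, iha hE.ite_thn fun p => hT (.thn p),
      ihb hE.ite_els fun p => hT (.els p)] with ρ hρ ha hb m hm hstay
    obtain ⟨c', h₁, h₂⟩ := hE.exists_succ_of_fst_eq hm (hρ m)
    have hc' : c'.1 = .pt (.thn a.entry) ∨ c'.1 = .pt (.els b.entry) := by
      rcases g with _ | p | φ
      · rcases h₁ with rfl | rfl <;> simp
      · rcases h₁ with rfl | rfl <;> simp
      · rcases h₁ with ⟨-, rfl⟩ | ⟨-, rfl⟩ <;> simp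
    have hexit : ∃ l > m + 1, (ρ l).1 = t := by
      rcases hc' with hc' | hc' <;> rw [hc'] at h₂
      · exact hE.ite_thn.exists_eq_exit hρ ⟨a.entry, h₂.symm⟩ (ha _ h₂)
      · exact hE.ite_els.exists_eq_exit hρ ⟨b.entry, h₂.symm⟩ (hb _ h₂)
    obtain ⟨l, hl, hl'⟩ := hexit
    obtain ⟨p, hp⟩ := hstay l (by omega)
    exact hE.exit p (hp.trans hl')
  | loop φ a _ =>
    filter_upwards [ae_all_iff.2 fun m => hE.ae_not_forall_mem_range σ hc₀ (hT .head φ a rfl) m]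
      with ρ hρ m hm hstay
    exact hρ m ⟨hm, hstay⟩

end Stmt

/-! ### Supermartingales bound the number of visits -/

/-- If `η` is non-negative at reachable configurations, never increases in expectation, and
decreases in expectation by some `ε > 0` in the location `ℓ₀`, then almost every run visits `ℓ₀` only
finitely often, since the expected number of visits is at most `η / ε`. -/
theorem PCFG.ae_finite_visits {L : Type} {n : ℕ} [MeasurableSpace L] [DiscreteMeasurableSpace L]
    [Finite L] {C : PCFG L n} {A : Set (Conf L n)} (σ : C.Scheduler A) {c₀ : Conf L n}
    (hc₀ : c₀ ∈ A) {η : L → Val n → ℝ} (hη : ∀ ℓ, Measurable (η ℓ))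
    (hpos : ∀ c, C.Reachable A c → 0 ≤ η c.1 c.2)
    (hr : ∀ c, C.Reachable A c → (C.node c.1).Ranked η (η c.1 c.2) c.2)
    {ℓ₀ : L} {ε : ℝ} (hε : 0 < ε)
    (hr₀ : ∀ x, C.Reachable A (ℓ₀, x) → (C.node ℓ₀).Ranked η (η ℓ₀ x - ε) x) :
    ∀ᵐ ρ ∂(runMeasure σ c₀), {k | (ρ k).1 = ℓ₀}.Finite := by
  have hprob : IsProbabilityMeasure (runMeasure σ c₀) := by unfold runMeasure; infer_instance
  set μ := runMeasure σ c₀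
  let F : Conf L n → ℝ≥0∞ := fun c => ENNReal.ofReal (η c.1 c.2)
  have hF : Measurable F :=
    (measurable_from_prod_countable_right (f := fun c : Conf L n => η c.1 c.2) hη).ennreal_ofReal
  let V : Set (Conf L n) := {c | c.1 = ℓ₀}
  have hV : MeasurableSet V := measurable_fst (measurableSet_singleton ℓ₀)
  have hstep : ∀ k {h : Hist L n k}, C.IsPath A h →
      ENNReal.ofReal ε * V.indicator 1 h.last + ∫⁻ c, F c ∂(step σ k h) ≤ F h.last := by
    intro k h hh
    have hreach := hh.reachable
    have hpos' : ∀ c, C.Succ h.last c → 0 ≤ η c.1 c.2 := fun c hc => by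
      obtain ⟨c₁, hc₁, hc₂⟩ := hreach
      exact hpos c ⟨c₁, hc₁, hc₂.tail hc⟩
    by_cases hl : h.last.1 = ℓ₀
    · obtain ⟨h₀, h₁⟩ := (hl ▸ hr₀ h.last.2 (hl ▸ hreach) :
        (C.node h.last.1).Ranked η (η h.last.1 h.last.2 - ε) h.last.2).lintegral_law_le hη hpos'
        (σ.choice k h) (σ.supported k h hh)
      rw [Set.indicator_of_mem (show h.last ∈ V from hl), Pi.one_apply, mul_one]
      refine (add_le_add_right h₁ _).trans ?_
      rw [← ENNReal.ofReal_add hε.le h₀, add_sub_cancel]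
    · rw [Set.indicator_of_notMem (show h.last ∉ V from hl), mul_zero, zero_add]
      exact ((hr _ hreach).lintegral_law_le hη hpos' (σ.choice k h) (σ.supported k h hh)).2
  let s : ℕ → Set (ℕ → Conf L n) := fun k => {ρ | (ρ k).1 = ℓ₀}
  have hs : ∀ k, MeasurableSet (s k) := fun k => measurable_pi_apply (X := fun _ => Conf L n) k hV
  have hdec : ∀ k, ENNReal.ofReal ε * μ (s k) + ∫⁻ ρ, F (ρ (k + 1)) ∂μ ≤ ∫⁻ ρ, F (ρ k) ∂μ := by
    intro k
    have h₁ : ∫⁻ ρ, F (ρ (k + 1)) ∂μ =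
        ∫⁻ ρ, ∫⁻ c, F c ∂(step σ k (frestrictLe (π := fun _ => Conf L n) k ρ)) ∂μ :=
      lintegral_traj_succ (κ := step σ) (Nat.zero_le k) (fun _ => c₀)
        (f := fun q => F q.2) (hF.comp measurable_snd)
    rw [h₁, ← lintegral_indicator_one (hs k),
      ← lintegral_const_mul _ (measurable_one.indicator (hs k)),
      ← lintegral_add_left ((measurable_one.indicator (hs k)).const_mul _)]
    refine lintegral_mono_ae ?_
    filter_upwards [ae_isPath σ hc₀] with ρ hρ
    exact hstep k (hρ k)
  have hsum : ∀ N, ∑ k ∈ Finset.range N, ENNReal.ofReal ε * μ (s k) + ∫⁻ ρ, F (ρ N) ∂μ ≤ F c₀ := by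
    intro N
    induction N with
    | zero =>
      have : ∀ᵐ ρ ∂μ, F (ρ 0) = F c₀ := by
        filter_upwards [ae_traj_frestrictLe_eq (κ := step σ) (a := 0) (fun _ => c₀)] with ρ hρ
        exact congrArg F (congrFun hρ ⟨0, Finset.mem_Iic.2 le_rfl⟩)
      rw [lintegral_congr_ae this]
      simp
    | succ N ih =>
      rw [Finset.sum_range_succ, add_assoc]
      exact (add_le_add_right (hdec N) _).trans ih
  refine ae_finite_setOfPred_mem (s := s) fun htop => ?_
  have hle : ∑' k, ENNReal.ofReal ε * μ (s k) ≤ F c₀ :=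
    ENNReal.tsum_le_of_sum_range_le fun N => le_self_add.trans (hsum N)
  rw [ENNReal.tsum_mul_left, htop, ENNReal.mul_top (by simpa using hε)] at hle
  exact ENNReal.ofReal_ne_top (top_le_iff.1 hle)

end PProg

end

/-! ### Almost-sure termination from a supermartingale -/

theorem theorem4 {n : ℕ} (init Ψ : PProg.Pred n) (B : PProg.Stmt n)
    (hnested : PProg.NestedLoopsTerminate init Ψ B)
    (hncsm : ∃ (I : (PProg.Stmt.loop Ψ B).Loc → Set (PProg.Val n))
      (η : (PProg.Stmt.loop Ψ B).Loc → PProg.Val n → ℝ),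
      (PProg.Program.mk init (PProg.Stmt.loop Ψ B)).IsInvariant I ∧ PProg.IsNCSM Ψ B I η) :
    (PProg.Program.mk init (PProg.Stmt.loop Ψ B)).ASTerminates := by
  obtain ⟨I, η, ⟨-, hI⟩, hη⟩ := hncsm
  obtain ⟨ε, hε, hrank⟩ := hη.ranking
  intro σ c hc
  -- the head of the outer loop belongs to the slice
  have hhead : PProg.Stmt.Loc.pt .head ∈ PProg.Stmt.slice Ψ B := by
    rintro ⟨p, -, hp⟩
    cases hp
  have hfin := PProg.PCFG.ae_finite_visits σ hc hη.measurable (fun c h => hη.nonneg _ _ (hI c h))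
    (fun c h => by
      by_cases hl : c.1 ∈ PProg.Stmt.loops Ψ B
      · simpa using hη.unaffecting _ hl _ (hI c h)
      · by_cases ht : c.1 = .out
        · -- the self-loop at the terminal location leaves `η` unchanged
          rw [ht]
          exact le_rfl (a := η .out c.2)
        · exact (hrank _ hl ht _ (hI c h)).mono (by linarith))
    hε (fun x h => hrank _ hhead (by rintro ⟨⟩) x (hI _ h))
  have hE := PProg.Stmt.embeds_body Ψ B
  filter_upwards [hfin, PProg.PCFG.ae_isPath σ hc, hE.ae_leaves σ hc hnested] with ρ hρ hpath hleave
  have hsucc : ∀ k, (PProg.Stmt.loop Ψ B).pcfg.Succ (ρ k) (ρ (k + 1)) := fun k =>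
    (hpath (k + 1)).2 k (Nat.lt_succ_self k)
  by_contra! hout
  have hnext : ∀ k, (ρ k).1 = .pt .head → ∃ k' > k, (ρ k').1 = .pt .head := by
    intro k hk
    have hk₁ : (ρ (k + 1)).1 = .pt (.body B.entry) := by
      have h := hsucc k
      rw [← Prod.mk.eta (p := ρ k), hk] at h
      rcases h with ⟨-, h⟩ | ⟨-, h⟩
      · rw [h]
      · exact absurd (congrArg Prod.fst h) (hout (k + 1))
    obtain ⟨k', hk', h⟩ := hE.exists_eq_exit hsucc ⟨B.entry, hk₁.symm⟩ (hleave _ hk₁)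
    exact ⟨k', by omega, h⟩
  -- a run that does not terminate returns to the head of the outer loop again and again
  refine Set.infinite_of_forall_exists_gt (s := {k | (ρ k).1 = .pt .head}) (fun N => ?_) hρ
  induction N with
  | zero =>
    obtain ⟨k, hk, h⟩ := hnext 0 (hpath 0).1.1
    exact ⟨k, h, hk⟩
  | succ N ih =>
    obtain ⟨k, h, hk⟩ := ih
    obtain ⟨k', hk', h'⟩ := hnext k h
    exact ⟨k', h', by omega⟩
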